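/- For integers $n\ge 0$ and $m\ge 1$, let $Q_n(m)$ be the Dowling lattice of the cyclic group $\mathbb Z/m\mathbb Z$ on $[n]=\{1,\dots,n\}$. Its elements are the classes of triples $(I,\pi,\gamma)$, where $I\subseteq[n]$ (the zero block, possibly empty), $\pi$ is a partition of $[n]\setminus I$ into nonempty (nonzero) blocks and $\gamma:[n]\setminus I\to\mathbb Z/m\mathbb Z$; two triples are in the same class if they have the same $I$ and the same $\pi$ and, on each block of $\pi$, their labellings differ by a constant. The order is the one generated by merging two blocks: a nonzero block may be absorbed into the zero block, and two nonzero blocks may be united after adding a constant to the labels of one of them. For $k\mid m$ and $k\mid d$ let $Q_n(m,d,k)$ be the subposet of $Q_n(m)$ consisting of the minimum $\hat 0$ of $Q_n(m)$ and of all elements such that every nonzero block $B$ has size divisible by $d$ and the number $|\{a\in B:\gamma(a)\equiv j \pmod k\}|$ does not depend on $j$. For a finite bounded poset $P$ write $\mu(P)=\mu_P(\hat 0,\hat 1)$. Let $d\ge 2$, $r\ge 1$ and $0\le e<d$ be integers. Then, as formal power series over $\mathbb Q$, \[ \sum_{n\ge 0}\mu\bigl(Q_{dn+e}(dr,d,d)\bigr)\,\frac{e!\,d^n\,x^n}{(dn+e)!\,r^{(d-1)n}}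 =-\left(\sum_{n\ge 0}\frac{e!\,d^n\,x^n}{(dn+e)!\,r^{(d-1)n}}\right)\left(\sum_{n\ge 0}\frac{d^n r^n x^n}{(n!)^{d}}\right)^{-\frac1{dr}}, \] where, for $e=0$, the symbol $\mu(Q_0(dr,d,d))$ in the term $n=0$ is read as $-1$ (that is, as the Möbius number of the one-element poset with a new minimum adjoined). Here, for a power series $f$ with constant term $1$ and $a\in\mathbb Q$, $f^{a}=\sum_{k\ge 0}\binom{a}{k}(f-1)^k$. -/

import Mathlib

open scoped Nat

/-! ### Dowling lattices -/

/-- A `G`-prepartition `(I, π, γ)` of a finite set `V`: the zero block `I ⊆ V`, a partition `π` of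
`V \ I` into non-empty (nonzero) blocks, and a labelling `γ` of the elements of the nonzero blocks
by elements of `G`.  The labelling is recorded as a map on all of `V`; its values on `I` are
irrelevant and are ignored by the equivalence `GPrepartition.IsEquivalent` below. -/
structure GPrepartition (V G : Type*) [Fintype V] [DecidableEq V] where
  zero : Finset V
  blocks : Finpartition zeroᶜ
  label : V → G

namespace GPrepartition

variable {V G : Type*} [Fintype V] [DecidableEq V]

theorem notMem_zero {P : GPrepartition V G} {B : Finset V} (hB : B ∈ P.blocks.parts) {a : V} (ha : a ∈ B) : a ∉ P.zero :=
  Finset.mem_compl.1 (P.blocks.le hB ha)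

/-- On the set `B`, the labelling of `Q` is a right translate of the labelling of `P`. -/
def LabelEq [Group G] (P Q : GPrepartition V G) (B : Finset V) : Prop :=
  ∃ g : G, ∀ a ∈ B, Q.label a = P.label a * g

/-- Two prepartitions are equivalent if they have the same zero block, the same nonzero blocks, and
on each nonzero block their labellings differ by right multiplication by an element of `G`. -/
def IsEquivalent [Group G] (P Q : GPrepartition V G) : Prop :=
  P.zero = Q.zero ∧ P.blocks.parts = Q.blocks.parts ∧ ∀ B ∈ P.blocks.parts, P.LabelEq Q B

/-- `Q` is obtained from `P` by merging blocks: each nonzero block of `P` is either absorbed by the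
zero block of `Q`, or lies in a nonzero block of `Q` whose labelling restricts to a right
translate of its own labelling. -/
def Le [Group G] (P Q : GPrepartition V G) : Prop :=
  P.zero ⊆ Q.zero ∧ ∀ B ∈ P.blocks.parts,
    B ⊆ Q.zero ∨ ∃ C ∈ Q.blocks.parts, B ⊆ C ∧ P.LabelEq Q B

variable [Group G] {P Q R : GPrepartition V G} {B C : Finset V}

theorem LabelEq.refl (P : GPrepartition V G) (B : Finset V) : P.LabelEq P B :=
  ⟨1, fun _ _ => by simp⟩

theorem LabelEq.symm (h : P.LabelEq Q B) : Q.LabelEq P B := by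
  obtain ⟨g, hg⟩ := h
  exact ⟨g⁻¹, fun a ha => by simp [hg a ha]⟩

theorem LabelEq.trans (h : P.LabelEq Q B) (h' : Q.LabelEq R B) : P.LabelEq R B := by
  obtain ⟨g, hg⟩ := h
  obtain ⟨k, hk⟩ := h'
  exact ⟨g * k, fun a ha => by rw [hk a ha, hg a ha, mul_assoc]⟩

theorem LabelEq.mono (h : P.LabelEq Q C) (hB : B ⊆ C) : P.LabelEq Q B := by
  obtain ⟨g, hg⟩ := h
  exact ⟨g, fun a ha => hg a (hB ha)⟩

theorem equiv_equivalence : Equivalence (IsEquivalent (V := V) (G := G)) where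
  refl P := ⟨rfl, rfl, fun B _ => LabelEq.refl P B⟩
  symm h := ⟨h.1.symm, h.2.1.symm, fun B hB => (h.2.2 B (h.2.1 ▸ hB)).symm⟩
  trans h h' := ⟨h.1.trans h'.1, h.2.1.trans h'.2.1,
    fun B hB => (h.2.2 B hB).trans (h'.2.2 B (h.2.1 ▸ hB))⟩

theorem IsEquivalent.le (h : P.IsEquivalent Q) : P.Le Q :=
  ⟨h.1.le, fun B hB => Or.inr ⟨B, h.2.1 ▸ hB, subset_rfl, h.2.2 B hB⟩⟩

theorem Le.trans (h : P.Le Q) (h' : Q.Le R) : P.Le R := by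
  refine ⟨h.1.trans h'.1, fun B hB => ?_⟩
  rcases h.2 B hB with hz | ⟨C, hC, hBC, hl⟩
  · exact Or.inl (hz.trans h'.1)
  · rcases h'.2 C hC with hz | ⟨D, hD, hCD, hl'⟩
    · exact Or.inl (hBC.trans hz)
    · exact Or.inr ⟨D, hD, hBC.trans hCD, hl.trans (hl'.mono hBC)⟩

theorem Le.parts_subset (h : P.Le Q) (h' : Q.Le P) :
    ∀ B ∈ P.blocks.parts, B ∈ Q.blocks.parts ∧ P.LabelEq Q B := by
  intro B hB
  obtain ⟨a, ha⟩ := P.blocks.nonempty_of_mem_parts hB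
  rcases h.2 B hB with hz | ⟨C, hC, hBC, hl⟩
  · exact absurd (h'.1 (hz ha)) (notMem_zero hB ha)
  · rcases h'.2 C hC with hz | ⟨D, hD, hCD, -⟩
    · exact absurd (hz (hBC ha)) (notMem_zero hB ha)
    · have hBD : B = D := P.blocks.eq_of_mem_parts hB hD ha (hCD (hBC ha))
      have hBC' : B = C := subset_antisymm hBC (hBD ▸ hCD)
      exact ⟨hBC' ▸ hC, hl⟩

theorem Le.antisymm (h : P.Le Q) (h' : Q.Le P) : P.IsEquivalent Q :=
  ⟨subset_antisymm h.1 h'.1,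
    Finset.Subset.antisymm (fun B hB => (h.parts_subset h' B hB).1)
      (fun B hB => (h'.parts_subset h B hB).1),
    fun B hB => (h.parts_subset h' B hB).2⟩

/-- Equivalence of `G`-prepartitions, as a setoid. -/
def setoid (V G : Type*) [Fintype V] [DecidableEq V] [Group G] : Setoid (GPrepartition V G) :=
  ⟨IsEquivalent, equiv_equivalence⟩

/-- The prepartition with empty zero block and singleton nonzero blocks. -/
def bot (V G : Type*) [Fintype V] [DecidableEq V] [Group G] : GPrepartition V G :=
  ⟨∅, ⊥, fun _ => 1⟩

/-- The prepartition with zero block `V` and no nonzero block. -/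
def top (V G : Type*) [Fintype V] [DecidableEq V] [Group G] : GPrepartition V G :=
  ⟨Finset.univ, ⊥, fun _ => 1⟩

theorem bot_le (P : GPrepartition V G) : (bot V G).Le P := by
  refine ⟨Finset.empty_subset _, fun B hB => ?_⟩
  obtain ⟨a, -, rfl⟩ := Finpartition.mem_bot_iff.1 hB
  by_cases ha : a ∈ P.zero
  · exact Or.inl (by simpa using ha)
  · obtain ⟨C, hC, haC⟩ := P.blocks.exists_mem (Finset.mem_compl.2 ha)
    exact Or.inr ⟨C, hC, by simpa using haC, P.label a, fun b hb => by
      obtain rfl := Finset.mem_singleton.1 hb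
      simp [bot]⟩

theorem le_top (P : GPrepartition V G) : P.Le (top V G) :=
  ⟨Finset.subset_univ _, fun B _ => Or.inl (Finset.subset_univ B)⟩

instance [Finite G] : Finite (GPrepartition V G) :=
  Finite.of_injective
    (fun P : GPrepartition V G => (P.zero, P.blocks.parts, P.label)) (by
      rintro ⟨z, b, l⟩ ⟨z', b', l'⟩ h
      simp only [Prod.mk.injEq] at h
      obtain ⟨rfl, h2, rfl⟩ := h
      obtain rfl := Finpartition.ext h2
      rfl)

end GPrepartition

/-- The Dowling lattice `Q_V(G)`: the set of `G`-partitions of `V`, that is, of equivalence classes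
of `G`-prepartitions. -/
def DowlingLattice (V G : Type*) [Fintype V] [DecidableEq V] [Group G] : Type _ :=
  Quotient (GPrepartition.setoid V G)

namespace DowlingLattice

open GPrepartition

variable {V G : Type*} [Fintype V] [DecidableEq V] [Group G]

/-- The `G`-partition represented by a `G`-prepartition. -/
def mk (P : GPrepartition V G) : DowlingLattice V G := Quotient.mk (setoid V G) P

/-- The order of the Dowling lattice; by `le_iff_reflTransGen_merge` below it is the order
generated by merging two blocks. -/
instance : PartialOrder (DowlingLattice V G) where
  le := Quotient.lift₂ Le (by
    intro P Q P' Q' h k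
    exact propext ⟨fun hl => ((equiv_equivalence.symm h).le.trans hl).trans (IsEquivalent.le k),
      fun hl => ((IsEquivalent.le h).trans hl).trans (equiv_equivalence.symm k).le⟩)
  le_refl := by rintro ⟨P⟩; exact (equiv_equivalence.refl P).le
  le_trans := by rintro ⟨P⟩ ⟨Q⟩ ⟨R⟩ h k; exact Le.trans h k
  le_antisymm := by rintro ⟨P⟩ ⟨Q⟩ h k; exact Quotient.sound (Le.antisymm h k)

theorem mk_le_mk {P Q : GPrepartition V G} : mk P ≤ mk Q ↔ P.Le Q := Iff.rfl

instance : BoundedOrder (DowlingLattice V G) where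
  bot := mk (GPrepartition.bot V G)
  bot_le := by rintro ⟨P⟩; exact GPrepartition.bot_le P
  top := mk (GPrepartition.top V G)
  le_top := by rintro ⟨P⟩; exact GPrepartition.le_top P

instance [Finite G] : Finite (DowlingLattice V G) :=
  inferInstanceAs (Finite (Quotient (GPrepartition.setoid V G)))

end DowlingLattice

/-! The order is the one generated by merging two blocks. -/

namespace GPrepartition

variable {V G : Type*} [Fintype V] [DecidableEq V] [Group G] {P Q R : GPrepartition V G}
  {B C : Finset V}

/-- `Q` is obtained from `P` by merging the zero block with a nonzero block `B`, or by
merging two nonzero blocks `B` and `C`, the labels on `C` being first translated by some `g`. -/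
def MergesTo (P Q : GPrepartition V G) : Prop :=
  (∃ B ∈ P.blocks.parts, Q.zero = P.zero ∪ B ∧ Q.blocks.parts = P.blocks.parts.erase B ∧
    ∀ a ∉ Q.zero, Q.label a = P.label a) ∨
  (∃ B ∈ P.blocks.parts, ∃ C ∈ P.blocks.parts, B ≠ C ∧ ∃ g : G, Q.zero = P.zero ∧
    Q.blocks.parts = insert (B ∪ C) ((P.blocks.parts.erase B).erase C) ∧
    ∀ a ∉ Q.zero, Q.label a = if a ∈ C then P.label a * g else P.label a)

theorem MergesTo.le (h : P.MergesTo Q) : P.Le Q := by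
  rcases h with ⟨B, hB, hz, hp, hl⟩ | ⟨B, hB, C, hC, hBC, g, hz, hp, hl⟩
  · refine ⟨hz ▸ Finset.subset_union_left, fun D hD => ?_⟩
    by_cases h : D = B
    · exact Or.inl (h ▸ hz ▸ Finset.subset_union_right)
    · have hD' : D ∈ Q.blocks.parts := hp ▸ Finset.mem_erase.2 ⟨h, hD⟩
      exact Or.inr ⟨D, hD', subset_rfl, 1, fun a ha => by
        rw [hl a (notMem_zero hD' ha), mul_one]⟩
  · refine ⟨hz.ge, fun D hD => Or.inr ?_⟩
    have hBC' : B ∪ C ∈ Q.blocks.parts := hp ▸ Finset.mem_insert_self _ _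
    by_cases h : D = C
    · subst h
      exact ⟨_, hBC', Finset.subset_union_right, g, fun a ha => by
        rw [hl a (notMem_zero hBC' (Finset.mem_union_right _ ha)), if_pos ha]⟩
    · have hl' : P.LabelEq Q D := ⟨1, fun a ha => by
        rw [hl a (hz ▸ notMem_zero hD ha), if_neg, mul_one]
        exact fun haC => h (P.blocks.eq_of_mem_parts hD hC ha haC)⟩
      by_cases h' : D = B
      · exact ⟨_, hBC', h' ▸ Finset.subset_union_left, hl'⟩
      · exact ⟨D, hp ▸ by simp [h, h', hD], subset_rfl, hl'⟩

theorem exists_merge_zero (h : P.Le Q) (hB : B ∈ P.blocks.parts) (hBQ : B ⊆ Q.zero) :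
    ∃ R : GPrepartition V G, P.MergesTo R ∧ R.Le Q ∧
      R.blocks.parts.card < P.blocks.parts.card := by
  refine ⟨⟨P.zero ∪ B, Finpartition.ofExistsUnique (P.blocks.parts.erase B) ?_ ?_ ?_, P.label⟩,
    Or.inl ⟨B, hB, rfl, rfl, fun _ _ => rfl⟩, ⟨Finset.union_subset h.1 hBQ, fun D hD => ?_⟩, ?_⟩
  · intro D hD a ha
    obtain ⟨hDB, hD⟩ := Finset.mem_erase.1 hD
    simp only [Finset.mem_compl, Finset.mem_union, not_or]
    exact ⟨notMem_zero hD ha, fun haB => hDB (P.blocks.eq_of_mem_parts hD hB ha haB)⟩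
  · intro a ha
    simp only [Finset.mem_compl, Finset.mem_union, not_or] at ha
    obtain ⟨D, hD, haD⟩ := P.blocks.exists_mem (Finset.mem_compl.2 ha.1)
    refine ⟨D, ⟨Finset.mem_erase.2 ⟨fun e => ha.2 (e ▸ haD), hD⟩, haD⟩, fun E hE => ?_⟩
    exact P.blocks.eq_of_mem_parts (Finset.mem_of_mem_erase hE.1) hD hE.2 haD
  · exact fun h0 => P.blocks.bot_notMem (Finset.mem_of_mem_erase h0)
  · exact h.2 D (Finset.mem_of_mem_erase hD)
  · exact Finset.card_erase_lt_of_mem hB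

theorem exists_merge_blocks (h : P.Le Q) {D : Finset V} (hB : B ∈ P.blocks.parts)
    (hC : C ∈ P.blocks.parts) (hne : B ≠ C) (hD : D ∈ Q.blocks.parts) (hBD : B ⊆ D) (hCD : C ⊆ D)
    (hlB : P.LabelEq Q B) (hlC : P.LabelEq Q C) :
    ∃ R : GPrepartition V G, P.MergesTo R ∧ R.Le Q ∧
      R.blocks.parts.card < P.blocks.parts.card := by
  obtain ⟨g, hg⟩ := hlB
  obtain ⟨k, hk⟩ := hlC
  have hBC : ∀ a ∈ B, a ∉ C := fun a ha ha' => hne (P.blocks.eq_of_mem_parts hB hC ha ha')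
  refine ⟨⟨P.zero, Finpartition.ofExistsUnique
      (insert (B ∪ C) ((P.blocks.parts.erase B).erase C)) ?_ ?_ ?_,
      fun a => if a ∈ C then P.label a * (k * g⁻¹) else P.label a⟩,
    Or.inr ⟨B, hB, C, hC, hne, k * g⁻¹, rfl, rfl, fun _ _ => rfl⟩, ⟨h.1, fun E hE => ?_⟩, ?_⟩
  · intro E hE
    rcases Finset.mem_insert.1 hE with rfl | hE
    · exact Finset.union_subset (P.blocks.le hB) (P.blocks.le hC)
    · exact P.blocks.le (Finset.mem_of_mem_erase (Finset.mem_of_mem_erase hE))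
  · intro a ha
    obtain ⟨E, hE, haE⟩ := P.blocks.exists_mem ha
    by_cases haBC : a ∈ B ∪ C
    · refine ⟨B ∪ C, ⟨Finset.mem_insert_self _ _, haBC⟩, fun F hF => ?_⟩
      rcases Finset.mem_insert.1 hF.1 with hF' | hF'
      · exact hF'
      · simp only [Finset.mem_erase] at hF'
        rcases Finset.mem_union.1 haBC with h1 | h1
        · exact absurd (P.blocks.eq_of_mem_parts hF'.2.2 hB hF.2 h1) hF'.2.1
        · exact absurd (P.blocks.eq_of_mem_parts hF'.2.2 hC hF.2 h1) hF'.1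
    · have haBC' := haBC
      simp only [Finset.mem_union, not_or] at haBC
      refine ⟨E, ⟨?_, haE⟩, fun F hF => ?_⟩
      · simp only [Finset.mem_insert, Finset.mem_erase]
        exact Or.inr ⟨fun e => haBC.2 (e ▸ haE), fun e => haBC.1 (e ▸ haE), hE⟩
      · rcases Finset.mem_insert.1 hF.1 with hF' | hF'
        · exact absurd (hF' ▸ hF.2) haBC'
        · simp only [Finset.mem_erase] at hF'
          exact P.blocks.eq_of_mem_parts hF'.2.2 hE hF.2 haE
  · intro h0
    obtain ⟨a, ha⟩ := P.blocks.nonempty_of_mem_parts hB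
    rcases Finset.mem_insert.1 h0 with h0 | h0
    · have : a ∈ B ∪ C := Finset.mem_union_left _ ha
      rw [← h0] at this
      simp at this
    · exact P.blocks.bot_notMem (Finset.mem_of_mem_erase (Finset.mem_of_mem_erase h0))
  · rcases Finset.mem_insert.1 hE with rfl | hE
    · refine Or.inr ⟨D, hD, Finset.union_subset hBD hCD, g, fun a ha => ?_⟩
      by_cases haC : a ∈ C
      · simp [haC, hk a haC, mul_assoc]
      · have haB : a ∈ B := (Finset.mem_union.1 ha).resolve_right haC
        simp [haC, hg a haB]
    · simp only [Finset.mem_erase] at hE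
      rcases h.2 E hE.2.2 with hz | ⟨F, hF, hEF, l, hl⟩
      · exact Or.inl hz
      · refine Or.inr ⟨F, hF, hEF, l, fun a ha => ?_⟩
        have haC : a ∉ C := fun haC => hE.1 (P.blocks.eq_of_mem_parts hE.2.2 hC ha haC)
        simp [haC, hl a ha]
  · have h1 : C ∈ P.blocks.parts.erase B := Finset.mem_erase.2 ⟨hne.symm, hC⟩
    have h2 := Finset.card_erase_lt_of_mem h1
    have h3 := Finset.card_erase_lt_of_mem hB
    exact (Finset.card_insert_le _ _).trans_lt (by omega)

theorem Le.equiv_or_exists_merge (h : P.Le Q) : P.IsEquivalent Q ∨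
    ∃ R : GPrepartition V G, P.MergesTo R ∧ R.Le Q ∧
      R.blocks.parts.card < P.blocks.parts.card := by
  by_cases h1 : ∃ B ∈ P.blocks.parts, B ⊆ Q.zero
  · obtain ⟨B, hB, hBQ⟩ := h1
    exact Or.inr (exists_merge_zero h hB hBQ)
  push Not at h1
  by_cases h2 : ∃ B ∈ P.blocks.parts, ∃ C ∈ P.blocks.parts, B ≠ C ∧
      ∃ D ∈ Q.blocks.parts, B ⊆ D ∧ C ⊆ D
  · obtain ⟨B, hB, C, hC, hne, D, hD, hBD, hCD⟩ := h2
    obtain ⟨-, -, -, hlB⟩ := (h.2 B hB).resolve_left (h1 B hB)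
    obtain ⟨-, -, -, hlC⟩ := (h.2 C hC).resolve_left (h1 C hC)
    exact Or.inr (exists_merge_blocks h hB hC hne hD hBD hCD hlB hlC)
  push Not at h2
  left
  have hz : Q.zero ⊆ P.zero := by
    intro a ha
    by_contra ha'
    obtain ⟨B, hB, haB⟩ := P.blocks.exists_mem (Finset.mem_compl.2 ha')
    obtain ⟨C, hC, hBC, -⟩ := (h.2 B hB).resolve_left (h1 B hB)
    exact notMem_zero hC (hBC haB) ha
  refine h.antisymm ⟨hz, fun D hD => Or.inr ?_⟩
  obtain ⟨a, ha⟩ := Q.blocks.nonempty_of_mem_parts hD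
  obtain ⟨B, hB, haB⟩ := P.blocks.exists_mem
    (Finset.mem_compl.2 fun h' => notMem_zero hD ha (h.1 h'))
  obtain ⟨D', hD', hBD', hl⟩ := (h.2 B hB).resolve_left (h1 B hB)
  obtain rfl := Q.blocks.eq_of_mem_parts hD' hD (hBD' haB) ha
  have hDB : D' ⊆ B := by
    intro b hb
    obtain ⟨C, hC, hbC⟩ := P.blocks.exists_mem
      (Finset.mem_compl.2 fun h' => notMem_zero hD hb (h.1 h'))
    obtain ⟨E, hE, hCE, -⟩ := (h.2 C hC).resolve_left (h1 C hC)
    obtain rfl := Q.blocks.eq_of_mem_parts hE hD (hCE hbC) hb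
    by_cases hBC : B = C
    · exact hBC ▸ hbC
    · exact absurd hCE (h2 B hB C hC hBC E hE hBD')
  exact ⟨B, hB, hDB, hl.symm.mono hDB⟩

end GPrepartition

namespace DowlingLattice

open GPrepartition

variable {V G : Type*} [Fintype V] [DecidableEq V] [Group G]

/-- The `G`-partition `y` is obtained from `x` by merging two blocks. -/
def Merge (x y : DowlingLattice V G) : Prop :=
  ∃ P Q : GPrepartition V G, mk P = x ∧ mk Q = y ∧ P.MergesTo Q

theorem le_iff_reflTransGen_merge {x y : DowlingLattice V G} :
    x ≤ y ↔ Relation.ReflTransGen Merge x y := by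
  constructor
  · obtain ⟨P, rfl⟩ := Quotient.exists_rep x
    obtain ⟨Q, rfl⟩ := Quotient.exists_rep y
    intro h
    induction hn : P.blocks.parts.card using Nat.strong_induction_on generalizing P with
    | _ n ih =>
      rcases Le.equiv_or_exists_merge h with h' | ⟨R, hPR, hRQ, hlt⟩
      · rw [Quotient.sound (s := setoid V G) h']
        exact .refl
      · exact .head ⟨P, R, rfl, rfl, hPR⟩ (ih _ (hn ▸ hlt) R hRQ rfl)
  · intro h
    induction h with
    | refl => exact le_rfl
    | tail _ h ih =>
      obtain ⟨P, Q, rfl, rfl, h⟩ := h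
      exact ih.trans h.le

end DowlingLattice

/-! ### The `d`-divisible, `k`-evenly coloured Dowling lattices -/

/-- The cyclic group `μ_r`, identified with `ℤ / r ℤ` (written multiplicatively). -/
abbrev CyclicGroup (r : ℕ) : Type := Multiplicative (ZMod r)

/-- All nonzero blocks have size divisible by `d`. -/
def GPrepartition.IsDivisible {V G : Type*} [Fintype V] [DecidableEq V]
    (P : GPrepartition V G) (d : ℕ) : Prop :=
  ∀ B ∈ P.blocks.parts, d ∣ B.card

/-- In every nonzero block `B`, the number of `a ∈ B` with `γ(a) ≡ j (mod k)` does not depend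
on `j`. -/
def GPrepartition.IsEvenlyColoured {V : Type*} [Fintype V] [DecidableEq V] {r : ℕ}
    (P : GPrepartition V (CyclicGroup r)) (k : ℕ) : Prop :=
  ∀ B ∈ P.blocks.parts, ∀ i j : ℕ,
    (B.filter fun a => (Multiplicative.toAdd (P.label a)).val ≡ i [MOD k]).card =
      (B.filter fun a => (Multiplicative.toAdd (P.label a)).val ≡ j [MOD k]).card

/-- The poset `Q_n(r, d, k)`: the subposet of the Dowling lattice `Q_n(r)` of `ℤ / r ℤ` on
`{1, …, n}` that consists of the `d`-divisible `k`-evenly coloured elements and of the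
minimum of `Q_n(r)` (for `k ∣ r`, so that colours modulo `k` are well defined up to translation). -/
def DivisibleDowling (n r d k : ℕ) : Type :=
  {x : DowlingLattice (Fin n) (CyclicGroup r) // x = ⊥ ∨
    ∃ P : GPrepartition (Fin n) (CyclicGroup r),
      DowlingLattice.mk P = x ∧ P.IsDivisible d ∧ P.IsEvenlyColoured k}

namespace DivisibleDowling

instance (n r d k : ℕ) : PartialOrder (DivisibleDowling n r d k) :=
  inferInstanceAs (PartialOrder {x : DowlingLattice (Fin n) (CyclicGroup r) // x = ⊥ ∨
    ∃ P : GPrepartition (Fin n) (CyclicGroup r),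
      DowlingLattice.mk P = x ∧ P.IsDivisible d ∧ P.IsEvenlyColoured k})

instance (n r d k : ℕ) : BoundedOrder (DivisibleDowling n r d k) where
  bot := ⟨⊥, Or.inl rfl⟩
  bot_le x := bot_le (a := x.1)
  top := ⟨⊤, Or.inr ⟨GPrepartition.top _ _, rfl,
    fun B hB => absurd (Finpartition.mem_bot_iff.1 hB) (by simp [GPrepartition.top]),
    fun B hB => absurd (Finpartition.mem_bot_iff.1 hB) (by simp [GPrepartition.top])⟩⟩
  le_top x := le_top (a := x.1)

instance (n r d k : ℕ) [NeZero r] : Finite (DivisibleDowling n r d k) :=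
  inferInstanceAs (Finite {x : DowlingLattice (Fin n) (CyclicGroup r) // x = ⊥ ∨
    ∃ P : GPrepartition (Fin n) (CyclicGroup r),
      DowlingLattice.mk P = x ∧ P.IsDivisible d ∧ P.IsEvenlyColoured k})

end DivisibleDowling

/-! ### Möbius numbers and powers of formal power series -/

open Classical in
/-- The Möbius number `μ(P) = μ(⊥, ⊤)` of a finite bounded poset. -/
noncomputable def mobiusNumber (P : Type*) [PartialOrder P] [BoundedOrder P] [Finite P] : ℤ :=
  letI := Fintype.ofFinite P
  letI : LocallyFiniteOrder P := Fintype.toLocallyFiniteOrder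
  IncidenceAlgebra.mu ℤ (⊥ : P) ⊤

/-- The power `f ^ a = ∑ k, (a choose k) (f - 1) ^ k` with rational exponent `a` of a formal power
series `f` with constant term `1`. -/
noncomputable def seriesPow (f : PowerSeries ℚ) (a : ℚ) : PowerSeries ℚ :=
  (PowerSeries.binomialSeries ℚ a).subst (f - 1)

/-! ### Partial maps to a set of labelled blocks and the partitions they induce -/

/-! Put $m=dr$ and let $N$ be the size of the ground set. The Möbius number is read off from a count
of colourings, as with a characteristic polynomial. A map
$\chi:[N]\to\{\text{none}\}\cup([q]\times\mathbb Z/m)$ induces a Dowling element `ofMap χ`. The maps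
whose induced element lies above a given $P$ are free choices of one value per nonzero block of $P$,
so there are $(qm+1)^{|\pi|}$ of them.

Only maps whose fibres are evenly coloured modulo $d$ are kept. Every map above an evenly coloured
$P$ is of this kind, so the count above each $y\ne\hat 0$ is unchanged. For $N\ne0$ no even map
induces $\hat 0$, since $d\ge2$. Möbius inversion at $\hat 0$ therefore gives $0=p(q)+\sum_{y\ne\hat
0}\mu(\hat 0,y)(qm+1)^{k(y)}$, where $p(q)$ counts all even maps and $k(y)$ is the number of nonzero
blocks of $y$. This is a polynomial identity in $q$. At $q=-1/m$ only $y=\hat 1$ survives, so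
$\mu=-p(-1/m)$ (`mobiusNumber_eq_neg_eval`).

A multinomial count (`card_evenMap`) shows that $p(q)$ is $(dn+e)!$ times the coefficient of $x^n$
in $A(x)E(x)^q$, where $N=dn+e$, $A$ accounts for the zero block and $E$ for one labelled block.
Coefficients of $A E^a$ are polynomial in $a$, so $q=-1/(dr)$ may be substituted. Rescaling $x$
gives the stated normalisation. -/

namespace GPrepartition

variable {V G ι : Type*} [Fintype V] [DecidableEq V]

open Classical in
/-- The prepartition induced by a map `χ : V → Option (ι × G)`: the zero block is the fibre of
`none`, the nonzero blocks are the nonempty fibres of the first component, and the labels are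
given by the second component. -/
noncomputable def ofMap [One G] (χ : V → Option (ι × G)) : GPrepartition V G where
  zero := Finset.univ.filter fun a => χ a = none
  blocks := Finpartition.ofExistsUnique
    ((Finset.univ.filter fun a => χ a ≠ none).image fun a =>
      Finset.univ.filter fun b => χ b ≠ none ∧ (χ b).map Prod.fst = (χ a).map Prod.fst)
    (by
      intro p hp b hb
      obtain ⟨a, -, rfl⟩ := Finset.mem_image.1 hp
      simpa using (Finset.mem_filter.1 hb).2.1)
    (by
      intro a ha
      have ha' : χ a ≠ none := by simpa using ha
      refine ⟨_, ⟨Finset.mem_image_of_mem _ (Finset.mem_filter.2 ⟨Finset.mem_univ a, ha'⟩),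
        by simp [ha']⟩, ?_⟩
      rintro t ⟨ht, hat⟩
      obtain ⟨c, -, rfl⟩ := Finset.mem_image.1 ht
      rw [(Finset.mem_filter.1 hat).2.2])
    (by
      intro h
      obtain ⟨a, ha, h⟩ := Finset.mem_image.1 h
      have : a ∈ (∅ : Finset V) := h ▸ Finset.mem_filter.2
        ⟨Finset.mem_univ a, (Finset.mem_filter.1 ha).2, rfl⟩
      simp at this)
  label := fun a => ((χ a).map Prod.snd).getD 1

theorem mem_zero_ofMap [One G] {χ : V → Option (ι × G)} {a : V} :
    a ∈ (ofMap χ).zero ↔ χ a = none := by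
  simp [ofMap]

theorem mem_parts_ofMap [One G] {χ : V → Option (ι × G)} {B : Finset V} :
    B ∈ (ofMap χ).blocks.parts ↔
      B.Nonempty ∧ ∃ i, ∀ b, b ∈ B ↔ ∃ g, χ b = some (i, g) := by
  classical
  constructor
  · intro h
    obtain ⟨a, ha, rfl⟩ := Finset.mem_image.1 h
    have ha' := (Finset.mem_filter.1 ha).2
    obtain ⟨⟨i, g⟩, hig⟩ := Option.ne_none_iff_exists'.1 ha'
    refine ⟨⟨a, by simp [ha']⟩, i, fun b => ?_⟩
    rcases hb : χ b with _ | ⟨j, k⟩ <;> simp [hig, hb]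
  · rintro ⟨⟨a, ha⟩, i, h⟩
    obtain ⟨g, hg⟩ := (h a).1 ha
    refine Finset.mem_image.2 ⟨a, by simp [hg], ?_⟩
    ext b
    rw [h]
    rcases hb : χ b with _ | ⟨j, k⟩ <;> simp [hg, hb]

theorem label_ofMap [One G] {χ : V → Option (ι × G)} {a : V} {i : ι} {g : G}
    (h : χ a = some (i, g)) : (ofMap χ).label a = g := by
  simp [ofMap, h]

variable [Group G] (P : GPrepartition V G)

/-- `P ≤ ofMap χ` says that `χ` is `none` on the zero block of `P` and a translate of the labelling
of `P` on each of its nonzero blocks. -/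
theorem le_ofMap_iff {χ : V → Option (ι × G)} :
    P.Le (ofMap χ) ↔ (∀ a ∈ P.zero, χ a = none) ∧ ∀ B ∈ P.blocks.parts,
      ∃ o : Option (ι × G), ∀ a ∈ B, χ a = o.map fun x => (x.1, P.label a * x.2) := by
  constructor
  · rintro ⟨hz, h⟩
    refine ⟨fun a ha => mem_zero_ofMap.1 (hz ha), fun B hB => ?_⟩
    rcases h B hB with h0 | ⟨C, hC, hBC, g, hg⟩
    · exact ⟨none, fun a ha => mem_zero_ofMap.1 (h0 ha)⟩
    · obtain ⟨-, i, hi⟩ := mem_parts_ofMap.1 hC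
      refine ⟨some (i, g), fun a ha => ?_⟩
      obtain ⟨k, hk⟩ := (hi a).1 (hBC ha)
      have := hg a ha
      rw [label_ofMap hk] at this
      simp [hk, this]
  · rintro ⟨hz, h⟩
    refine ⟨fun a ha => mem_zero_ofMap.2 (hz a ha), fun B hB => ?_⟩
    obtain ⟨_ | ⟨i, g⟩, ho⟩ := h B hB
    · exact Or.inl fun a ha => mem_zero_ofMap.2 (ho a ha)
    · classical
      obtain ⟨a₀, ha₀⟩ := P.blocks.nonempty_of_mem_parts hB
      have hsub : ∀ a ∈ B, ∃ k, χ a = some (i, k) := fun a ha => ⟨_, ho a ha⟩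
      refine Or.inr ⟨Finset.univ.filter fun b => ∃ k, χ b = some (i, k),
        mem_parts_ofMap.2 ⟨⟨a₀, by simpa using hsub a₀ ha₀⟩, i, fun b => by simp⟩,
        fun a ha => by simpa using hsub a ha, g, fun a ha => ?_⟩
      exact label_ofMap (ho a ha)

/-- The map given by a map on the nonzero blocks of `P`, twisted by the labels of `P`. -/
noncomputable def extendMap (η : P.blocks.parts → Option (ι × G)) (a : V) : Option (ι × G) :=
  if h : a ∈ P.zero then none
  else (η ⟨P.blocks.part a, P.blocks.part_mem.2 (Finset.mem_compl.2 h)⟩).map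
    fun x => (x.1, P.label a * x.2)

theorem extendMap_of_mem (η : P.blocks.parts → Option (ι × G)) {B : Finset V}
    (hB : B ∈ P.blocks.parts) {a : V} (ha : a ∈ B) :
    P.extendMap η a = (η ⟨B, hB⟩).map fun x => (x.1, P.label a * x.2) := by
  obtain rfl := P.blocks.part_eq_of_mem hB ha
  rw [extendMap, dif_neg (notMem_zero hB ha)]

theorem extendMap_injective :
    Function.Injective (P.extendMap : (P.blocks.parts → Option (ι × G)) → V → Option (ι × G)) := by
  intro η η' h
  funext ⟨B, hB⟩
  obtain ⟨a, ha⟩ := P.blocks.nonempty_of_mem_parts hB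
  have h1 := congrFun h a
  rw [extendMap_of_mem P η hB ha, extendMap_of_mem P η' hB ha] at h1
  refine Option.map_injective ?_ h1
  rintro ⟨i, g⟩ ⟨j, k⟩ h
  simpa using h

theorem le_ofMap_iff_exists_extendMap {χ : V → Option (ι × G)} :
    P.Le (ofMap χ) ↔ ∃ η, P.extendMap η = χ := by
  rw [le_ofMap_iff]
  constructor
  · rintro ⟨hz, h⟩
    choose o ho using h
    refine ⟨fun B => o B.1 B.2, funext fun a => ?_⟩
    by_cases ha : a ∈ P.zero
    · rw [extendMap, dif_pos ha, hz a ha]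
    · obtain ⟨B, hB, haB⟩ := P.blocks.exists_mem (Finset.mem_compl.2 ha)
      rw [extendMap_of_mem P _ hB haB, ho B hB a haB]
  · rintro ⟨η, rfl⟩
    exact ⟨fun a ha => by rw [extendMap, dif_pos ha],
      fun B hB => ⟨η ⟨B, hB⟩, fun a ha => P.extendMap_of_mem η hB ha⟩⟩

/-- `extendMap` parametrises these maps bijectively by one element of `Option (ι × G)` per nonzero
block; the summand 1 is absorption into the zero block. -/
theorem card_le_ofMap [Finite G] [Finite ι] :
    Nat.card {χ : V → Option (ι × G) // P.Le (ofMap χ)} =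
      (Nat.card ι * Nat.card G + 1) ^ P.blocks.parts.card := by
  have e : {χ : V → Option (ι × G) // P.Le (ofMap χ)} =
      Set.range (P.extendMap : (P.blocks.parts → Option (ι × G)) → V → Option (ι × G)) := by
    congr 1
    ext χ
    exact P.le_ofMap_iff_exists_extendMap
  rw [e, ← Nat.card_congr (Equiv.ofInjective _ P.extendMap_injective), Nat.card_fun,
    Finite.card_option, Nat.card_prod]
  simp

end GPrepartition

/-! ### Evenly coloured maps -/

section Even

variable {V ι : Type*} [Fintype V] [DecidableEq V]

open Classical in
/-- On every fibre of the first component of `χ`, the colours modulo `d` of the second component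
are equidistributed. -/
def EvenMap {m : ℕ} (d : ℕ) (χ : V → Option (ι × CyclicGroup m)) : Prop :=
  ∀ i : ι, ∀ j k : ℕ,
    (Finset.univ.filter fun a => ∃ g, χ a = some (i, g) ∧ g.toAdd.val ≡ j [MOD d]).card =
      (Finset.univ.filter fun a => ∃ g, χ a = some (i, g) ∧ g.toAdd.val ≡ k [MOD d]).card

namespace GPrepartition

theorem EvenMap.isEvenlyColoured {m d : ℕ} {χ : V → Option (ι × CyclicGroup m)}
    (h : EvenMap d χ) : (ofMap χ).IsEvenlyColoured d := by
  classical
  intro B hB j k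
  obtain ⟨-, i, hi⟩ := mem_parts_ofMap.1 hB
  have key : ∀ j : ℕ, (B.filter fun a => ((ofMap χ).label a).toAdd.val ≡ j [MOD d]) =
      Finset.univ.filter fun a => ∃ g, χ a = some (i, g) ∧ g.toAdd.val ≡ j [MOD d] := by
    intro j
    ext a
    simp only [Finset.mem_filter, Finset.mem_univ, true_and, hi]
    constructor
    · rintro ⟨⟨g, hg⟩, h⟩
      exact ⟨g, hg, by rwa [label_ofMap hg] at h⟩
    · rintro ⟨g, hg, h⟩
      exact ⟨⟨g, hg⟩, by rwa [label_ofMap hg]⟩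
  rw [key j, key k]
  convert h i j k

/-- A block is the disjoint union of $d$ colour classes of equal size, so for $k=d$ the divisibility
condition is automatic. -/
theorem IsEvenlyColoured.isDivisible {m d : ℕ} (hd : 0 < d) {P : GPrepartition V (CyclicGroup m)}
    (h : P.IsEvenlyColoured d) : P.IsDivisible d := by
  intro B hB
  rw [Finset.card_eq_sum_card_fiberwise
    (f := fun a => (P.label a).toAdd.val % d) (t := Finset.range d)
    (fun a _ => by simpa using Nat.mod_lt _ hd)]
  rw [Finset.sum_congr rfl (g := fun _ =>
    (B.filter fun a => (P.label a).toAdd.val ≡ 0 [MOD d]).card)]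
  · simp
  · intro j hj
    rw [← h B hB j 0]
    congr 1
    ext a
    simp [Nat.ModEq, Nat.mod_eq_of_lt (Finset.mem_range.1 hj)]

/-- Translating labels permutes the colours. -/
theorem card_filter_mul_right {α : Type*} {m d : ℕ} [NeZero m] (hd : 0 < d) (hdm : d ∣ m)
    (γ : α → CyclicGroup m) (B : Finset α)
    (h : ∀ j k : ℕ, (B.filter fun a => (γ a).toAdd.val ≡ j [MOD d]).card =
      (B.filter fun a => (γ a).toAdd.val ≡ k [MOD d]).card) (g : CyclicGroup m) (j : ℕ) :
    (B.filter fun a => (γ a * g).toAdd.val ≡ j [MOD d]).card =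
      (B.filter fun a => (γ a).toAdd.val ≡ 0 [MOD d]).card := by
  -- The colour $j-g$ modulo $d$, written without subtraction in `ℕ`.
  rw [h 0 (j + (d - 1) * g.toAdd.val)]
  congr 1
  ext a
  have h1 : (γ a * g).toAdd.val ≡ (γ a).toAdd.val + g.toAdd.val [MOD d] := by
    rw [toAdd_mul, ZMod.val_add]
    exact Nat.ModEq.of_dvd hdm (Nat.mod_modEq _ _)
  have h2 : j + (d - 1) * g.toAdd.val + g.toAdd.val ≡ j [MOD d] := by
    obtain ⟨c, rfl⟩ : ∃ c, d = c + 1 := ⟨d - 1, by omega⟩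
    have : j + (c + 1 - 1) * g.toAdd.val + g.toAdd.val = j + (c + 1) * g.toAdd.val := by
      rw [Nat.add_sub_cancel]; ring
    rw [this]
    simp [Nat.ModEq]
  simp only [Finset.mem_filter, and_congr_right_iff]
  intro _
  constructor
  · intro h3
    exact Nat.ModEq.add_right_cancel' _ ((h1.symm.trans h3).trans h2.symm)
  · intro h3
    exact (h1.trans (h3.add_right _)).trans h2

/-- Each fibre of `χ` is a union of blocks of `P` with translated labels. Translation permutes the
colours modulo $d$ because $d\mid m$, and unions of evenly coloured sets stay even. -/
theorem IsEvenlyColoured.evenMap {m d : ℕ} [NeZero m] (hd : 0 < d) (hdm : d ∣ m)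
    {P : GPrepartition V (CyclicGroup m)} (hP : P.IsEvenlyColoured d)
    {χ : V → Option (ι × CyclicGroup m)} (h : P.Le (ofMap χ)) : EvenMap d χ := by
  classical
  obtain ⟨hz, h⟩ := P.le_ofMap_iff.1 h
  intro i j k
  have key : ∀ j : ℕ,
      (Finset.univ.filter fun a => ∃ g, χ a = some (i, g) ∧ g.toAdd.val ≡ j [MOD d]).card =
      ∑ B ∈ P.blocks.parts,
        (B.filter fun a => ∃ g, χ a = some (i, g) ∧ g.toAdd.val ≡ j [MOD d]).card := by
    intro j
    rw [← Finset.card_biUnion]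
    · congr 1
      ext a
      simp only [Finset.mem_filter, Finset.mem_univ, true_and, Finset.mem_biUnion]
      constructor
      · rintro ⟨g, hg⟩
        obtain ⟨B, hB, haB⟩ := P.blocks.exists_mem (a := a)
          (Finset.mem_compl.2 fun h0 => by simp [hz a h0] at hg)
        exact ⟨B, hB, haB, g, hg⟩
      · rintro ⟨B, -, -, h⟩
        exact h
    · intro B hB C hC hne
      exact Finset.disjoint_filter_filter (P.blocks.disjoint hB hC hne)
  have key2 : ∀ B ∈ P.blocks.parts, ∀ j k : ℕ,
      (B.filter fun a => ∃ g, χ a = some (i, g) ∧ g.toAdd.val ≡ j [MOD d]).card =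
      (B.filter fun a => ∃ g, χ a = some (i, g) ∧ g.toAdd.val ≡ k [MOD d]).card := by
    intro B hB j k
    obtain ⟨o, ho⟩ := h B hB
    -- A block of `P` either lies wholly in the fibre over `i` or misses it.
    by_cases hi : ∃ g, o = some (i, g)
    · obtain ⟨g, rfl⟩ := hi
      have key3 : ∀ j : ℕ,
          (B.filter fun a => ∃ g, χ a = some (i, g) ∧ g.toAdd.val ≡ j [MOD d]) =
          B.filter fun a => (P.label a * g).toAdd.val ≡ j [MOD d] := by
        intro j
        refine Finset.filter_congr fun a ha => ?_
        simp [ho a ha]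
      rw [key3, key3, card_filter_mul_right hd hdm _ _ (hP B hB),
        card_filter_mul_right hd hdm _ _ (hP B hB)]
    · have key3 : ∀ j : ℕ,
          (B.filter fun a => ∃ g, χ a = some (i, g) ∧ g.toAdd.val ≡ j [MOD d]) = ∅ := by
        intro j
        refine Finset.filter_eq_empty_iff.2 fun a ha => ?_
        rintro ⟨g, hg, -⟩
        rcases o with _ | ⟨i', g'⟩
        · simp [ho a ha] at hg
        · rw [ho a ha] at hg
          simp only [Option.map_some, Option.some.injEq, Prod.mk.injEq] at hg
          exact hi ⟨g', by rw [hg.1]⟩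
      rw [key3, key3]
  have := (key j).trans ((Finset.sum_congr rfl fun B hB => key2 B hB j k).trans (key k).symm)
  convert this

end GPrepartition

end Even

/-! ### Möbius inversion over evenly coloured maps -/

namespace DivisibleDowling

open GPrepartition

/-- The element of `Q_n(m, d, d)` induced by an evenly coloured map. -/
noncomputable def ofEvenMap {n m d : ℕ} {ι : Type*} (hd : 0 < d)
    (χ : {χ : Fin n → Option (ι × CyclicGroup m) // EvenMap d χ}) : DivisibleDowling n m d d :=
  ⟨DowlingLattice.mk (ofMap χ.1), Or.inr ⟨_, rfl, (EvenMap.isEvenlyColoured χ.2).isDivisible hd,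
    EvenMap.isEvenlyColoured χ.2⟩⟩

/-- The minimum has singleton blocks, whose size is not divisible by $d\ge2$. -/
theorem ofEvenMap_ne_bot {n m d : ℕ} {ι : Type*} (hd : 2 ≤ d) (hn : n ≠ 0)
    (χ : {χ : Fin n → Option (ι × CyclicGroup m) // EvenMap d χ}) :
    ofEvenMap (Nat.zero_lt_of_lt hd) χ ≠ ⊥ := by
  intro h
  have h1 : (ofMap χ.1).Le (GPrepartition.bot _ _) := by
    have h2 : (ofEvenMap (Nat.zero_lt_of_lt hd) χ).1 ≤
      (⊥ : DowlingLattice (Fin n) (CyclicGroup m)) := by rw [h]; exact le_rfl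
    exact h2
  have h2 := (GPrepartition.bot_le _).antisymm h1
  have h3 : ({⟨0, Nat.pos_of_ne_zero hn⟩} : Finset (Fin n)) ∈ (ofMap χ.1).blocks.parts := by
    rw [← h2.2.1]
    exact Finpartition.mem_bot_iff.2 ⟨_, by simp [GPrepartition.bot], rfl⟩
  have h4 := (EvenMap.isEvenlyColoured χ.2).isDivisible (Nat.zero_lt_of_lt hd) _ h3
  have := Nat.le_of_dvd (by simp) h4
  simp at this
  omega

/-- The number of evenly coloured maps whose induced partition lies above `y ≠ ⊥` is a power, with
exponent zero if and only if `y = ⊤`. -/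
theorem exists_card_le_ofEvenMap {n m d : ℕ} [NeZero m] (hd : 0 < d) (hdm : d ∣ m)
    {y : DivisibleDowling n m d d} (hy : y ≠ ⊥) :
    ∃ k : ℕ, (k = 0 ↔ y = ⊤) ∧ ∀ q : ℕ,
      Nat.card {χ : {χ : Fin n → Option (Fin q × CyclicGroup m) // EvenMap d χ} //
        y ≤ ofEvenMap hd χ} = (q * m + 1) ^ k := by
  obtain ⟨P, hP, -, hP'⟩ := y.2.resolve_left fun h => hy (Subtype.ext h)
  refine ⟨P.blocks.parts.card, ?_, fun q => ?_⟩
  · constructor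
    · intro h
      refine Subtype.ext ?_
      rw [← hP]
      refine le_antisymm (GPrepartition.le_top P) ?_
      have hz : P.zeroᶜ = ∅ := P.blocks.parts_eq_empty_iff.1 (Finset.card_eq_zero.1 h)
      have hz' : P.zero = Finset.univ := by simpa using hz
      refine ⟨hz'.symm.subset, fun B hB => ?_⟩
      exact absurd (Finpartition.mem_bot_iff.1 hB) (by simp [GPrepartition.top])
    · intro h
      have h1 : (GPrepartition.top _ _).Le P := by
        have : (⊤ : DowlingLattice (Fin n) (CyclicGroup m)) ≤ DowlingLattice.mk P := by
          rw [hP, h]; exact le_rfl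
        exact this
      have h2 : P.zeroᶜ = ∅ := by
        rw [Finset.compl_eq_empty_iff]
        exact Finset.univ_subset_iff.1 h1.1
      rw [Finset.card_eq_zero]
      exact P.blocks.parts_eq_empty_iff.2 h2
  · have h := P.card_le_ofMap (ι := Fin q)
    rw [Nat.card_fin, Nat.card_congr Multiplicative.toAdd, Nat.card_zmod] at h
    rw [← h]
    refine Nat.card_congr ((Equiv.subtypeSubtypeEquivSubtypeExists _ _).trans
      (Equiv.subtypeEquivRight fun χ => ?_))
    have hiff : ∀ hχ : EvenMap d χ, y ≤ ofEvenMap hd ⟨χ, hχ⟩ ↔ P.Le (ofMap χ) := by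
      intro hχ
      change y.1 ≤ DowlingLattice.mk (ofMap χ) ↔ _
      rw [← hP]
      rfl
    constructor
    · rintro ⟨hχ, h⟩
      exact (hiff hχ).1 h
    · intro h
      exact ⟨hP'.evenMap hd hdm h, (hiff _).2 h⟩

theorem bot_ne_top {n m d k : ℕ} (hn : n ≠ 0) : (⊥ : DivisibleDowling n m d k) ≠ ⊤ := by
  intro h
  have h1 : (GPrepartition.top (Fin n) (CyclicGroup m)).Le (GPrepartition.bot _ _) := by
    have : (⊤ : DivisibleDowling n m d k).1 ≤ (⊥ : DivisibleDowling n m d k).1 := by rw [h]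
    exact this
  have := h1.1 (Finset.mem_univ ⟨0, Nat.pos_of_ne_zero hn⟩)
  simp [GPrepartition.bot] at this

open Polynomial in
/-- If the number of evenly coloured maps to `q` labelled blocks is polynomial in `q`, then the
Möbius number is minus the value of this polynomial at `-1 / m`. -/
theorem mobiusNumber_eq_neg_eval {n m d : ℕ} [NeZero m] (hd : 2 ≤ d) (hdm : d ∣ m) (hn : n ≠ 0)
    (p : ℚ[X]) (hp : ∀ q : ℕ, (Nat.card {χ : Fin n → Option (Fin q × CyclicGroup m) //
      EvenMap d χ} : ℚ) = p.eval (q : ℚ)) :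
    (mobiusNumber (DivisibleDowling n m d d) : ℚ) = -p.eval (-1 / (m : ℚ)) := by
  classical
  have hd0 : 0 < d := Nat.zero_lt_of_lt hd
  let : Fintype (DivisibleDowling n m d d) := Fintype.ofFinite _
  let : LocallyFiniteOrder (DivisibleDowling n m d d) := Fintype.toLocallyFiniteOrder
  set μ : DivisibleDowling n m d d → ℤ := fun y => IncidenceAlgebra.mu ℤ ⊥ y with hμ
  have hmob : mobiusNumber (DivisibleDowling n m d d) = μ ⊤ := by
    unfold mobiusNumber
    rw [hμ]
  -- The exponent at `⊥` is a dummy value; that term is split off below.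
  have hex : ∀ y : DivisibleDowling n m d d, ∃ k : ℕ, y ≠ ⊥ → (k = 0 ↔ y = ⊤) ∧ ∀ q : ℕ,
      Nat.card {χ : {χ : Fin n → Option (Fin q × CyclicGroup m) // EvenMap d χ} //
        y ≤ ofEvenMap hd0 χ} = (q * m + 1) ^ k := by
    intro y
    by_cases hy : y = ⊥
    · exact ⟨0, fun h => absurd hy h⟩
    · obtain ⟨k, hk⟩ := exists_card_le_ofEvenMap hd0 hdm hy
      exact ⟨k, fun _ => hk⟩
  choose k hk using hex
  have hinv : ∀ q : ℕ, (0 : ℤ) =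
      (Nat.card {χ : Fin n → Option (Fin q × CyclicGroup m) // EvenMap d χ} : ℤ) +
        ∑ y ∈ Finset.univ.erase ⊥, μ y * ((q * m + 1 : ℕ) : ℤ) ^ k y := by
    intro q
    let : Fintype {χ : Fin n → Option (Fin q × CyclicGroup m) // EvenMap d χ} :=
      Fintype.ofFinite _
    have h1 := IncidenceAlgebra.moebius_inversion_top (𝕜 := ℤ)
      (fun y => ((Finset.univ.filter fun χ : {χ : Fin n → Option (Fin q × CyclicGroup m) //
        EvenMap d χ} => ofEvenMap hd0 χ = y).card : ℤ))
      (fun y => ((Finset.univ.filter fun χ : {χ : Fin n → Option (Fin q × CyclicGroup m) //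
        EvenMap d χ} => y ≤ ofEvenMap hd0 χ).card : ℤ)) (by
        intro x
        rw [Finset.card_eq_sum_card_fiberwise (f := ofEvenMap hd0) (t := Finset.Ici x)
          (fun χ hχ => by simpa using hχ)]
        push_cast
        refine Finset.sum_congr rfl fun y hy => ?_
        congr 2
        ext χ
        simp only [Finset.mem_filter, Finset.mem_univ, true_and, and_iff_right_iff_imp]
        rintro rfl
        simpa using hy) ⊥
    have h2 : (Finset.univ.filter fun χ : {χ : Fin n → Option (Fin q × CyclicGroup m) //
        EvenMap d χ} => ofEvenMap hd0 χ = ⊥) = ∅ :=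
      Finset.filter_eq_empty_iff.2 fun χ _ => ofEvenMap_ne_bot hd hn χ
    rw [h2, Finset.card_empty, Nat.cast_zero] at h1
    -- At `⊥` the coefficient is 1 and every even map is counted, which produces the total number of
    -- even maps.
    rw [h1, Finset.Ici_bot, ← Finset.add_sum_erase _ _ (Finset.mem_univ ⊥)]
    congr 1
    · simp [Nat.card_eq_fintype_card]
    · refine Finset.sum_congr rfl fun y hy => ?_
      have h3 := (hk y (Finset.ne_of_mem_erase hy)).2 q
      rw [Nat.card_eq_fintype_card, Fintype.card_subtype] at h3
      rw [hμ, h3]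
      push_cast
      rfl
  have hpoly : (0 : ℚ[X]) =
      p + ∑ y ∈ Finset.univ.erase ⊥, C (μ y : ℚ) * (C (m : ℚ) * X + 1) ^ k y := by
    refine Polynomial.eq_of_infinite_eval_eq _ _
      (Set.infinite_of_injective_forall_mem (f := fun q : ℕ => (q : ℚ)) Nat.cast_injective ?_)
    intro q
    have := congrArg (Int.cast : ℤ → ℚ) (hinv q)
    push_cast at this
    simp only [Set.mem_ofPred_eq, eval_zero, eval_add, eval_finsetSum, eval_mul, eval_pow, eval_C,
      eval_X, eval_one, ← hp]
    rw [this]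
    simp only [mul_comm]
  have heval := congrArg (Polynomial.eval (-1 / (m : ℚ))) hpoly
  have hm : (m : ℚ) ≠ 0 := Nat.cast_ne_zero.2 (NeZero.ne m)
  -- All powers with positive exponent vanish here; only `⊤`, with exponent 0, contributes.
  have h0 : (m : ℚ) * (-1 / (m : ℚ)) + 1 = 0 := by field_simp; ring
  simp only [eval_zero, eval_add, eval_finsetSum, eval_mul, eval_pow, eval_C,
      eval_X, eval_one, h0] at heval
  rw [Finset.sum_eq_single_of_mem ⊤ (Finset.mem_erase.2 ⟨(bot_ne_top hn).symm, Finset.mem_univ _⟩),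
    ((hk ⊤ (bot_ne_top hn).symm).1).2 rfl] at heval
  · rw [hmob]
    simp at heval
    linarith
  · intro y hy hy'
    have : k y ≠ 0 := fun h => hy' (((hk y (Finset.ne_of_mem_erase hy)).1).1 h)
    simp [this]

end DivisibleDowling

/-! ### Powers of series and a product formula for counting maps by fibres -/

section Series

open PowerSeries

theorem hasSubst_sub_one {f : ℚ⟦X⟧} (hf : constantCoeff f = 1) : HasSubst (f - 1) :=
  HasSubst.of_constantCoeff_zero' (by simp [hf])

/-- Coefficients of `A * f ^ a` are given by finite sums. -/
theorem coeff_mul_seriesPow {f : ℚ⟦X⟧} (hf : constantCoeff f = 1) (A : ℚ⟦X⟧) (a : ℚ) (n : ℕ) :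
    coeff n (A * seriesPow f a) =
      ∑ k ∈ Finset.range (n + 1), Ring.choose a k * coeff n (A * (f - 1) ^ k) := by
  have hs := hasSubst_sub_one hf
  have hdvd : ∀ k, X ^ k ∣ (f - 1) ^ k := fun k =>
    pow_dvd_pow_of_dvd (X_dvd_iff.2 (by simp [hf])) k
  -- Split the binomial series into its truncation and a multiple of $X^{n+1}$. After substituting
  -- `f - 1`, which is divisible by `X`, the second part cannot reach degree `n`.
  obtain ⟨h, hh⟩ := (X_pow_dvd_iff  (R := ℚ)).2 (show ∀ m < n + 1, coeff m
    (PowerSeries.binomialSeries ℚ a - ((trunc (n + 1) (PowerSeries.binomialSeries ℚ a) : Polynomial ℚ) : ℚ⟦X⟧)) = 0 by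
      intro m hm
      rw [map_sub, Polynomial.coeff_coe, coeff_trunc, if_pos hm, sub_self])
  have key : seriesPow f a =
      (∑ k ∈ Finset.range (n + 1), C (Ring.choose a k) * (f - 1) ^ k) +
        (f - 1) ^ (n + 1) * h.subst (f - 1) := by
    rw [seriesPow, sub_eq_iff_eq_add.1 hh, add_comm, subst_add hs, subst_mul hs, subst_pow hs,
      subst_X hs, subst_coe hs, Polynomial.aeval_def,
      Polynomial.eval₂_eq_sum_range' _ (natDegree_trunc_lt _ n)]
    congr 1
    refine Finset.sum_congr rfl fun k hk => ?_
    rw [coeff_trunc, if_pos (Finset.mem_range.1 hk), binomialSeries_coeff, smul_eq_mul, mul_one]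
    rfl
  have h0 : coeff n (A * ((f - 1) ^ (n + 1) * h.subst (f - 1))) = 0 :=
    X_pow_dvd_iff.1 (((hdvd (n + 1)).mul_right _).mul_left A) n (Nat.lt_succ_self n)
  rw [key, mul_add, map_add, h0, add_zero, Finset.mul_sum, map_sum]
  refine Finset.sum_congr rfl fun k _ => ?_
  rw [mul_left_comm, coeff_C_mul]

theorem seriesPow_natCast {f : ℚ⟦X⟧} (hf : constantCoeff f = 1) (q : ℕ) :
    seriesPow f (q : ℚ) = f ^ q := by
  have hs := hasSubst_sub_one hf
  have h1 : ((1 : ℚ⟦X⟧)).subst (f - 1) = (1 : ℚ⟦X⟧) := by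
    rw [← coe_substAlgHom hs, map_one]
  rw [seriesPow, binomialSeries_nat, subst_pow hs, subst_add hs, subst_X hs, h1,
    add_sub_cancel]

/-- The coefficients of `A * f ^ a` depend polynomially on `a`. -/
theorem exists_polynomial_coeff_mul_seriesPow {f : ℚ⟦X⟧} (hf : constantCoeff f = 1)
    (A : ℚ⟦X⟧) (n : ℕ) :
    ∃ p : Polynomial ℚ, ∀ a : ℚ, p.eval a = coeff n (A * seriesPow f a) := by
  -- This is the finite sum of `coeff_mul_seriesPow`, with $\binom ak$ written as a falling
  -- factorial over $k!$.
  refine ⟨∑ k ∈ Finset.range (n + 1), descPochhammer ℚ k *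
    Polynomial.C ((k ! : ℚ)⁻¹ * coeff n (A * (f - 1) ^ k)), fun a => ?_⟩
  rw [coeff_mul_seriesPow hf, Polynomial.eval_finsetSum]
  refine Finset.sum_congr rfl fun k _ => ?_
  have h : (descPochhammer ℚ k).eval a = (k ! : ℚ) * Ring.choose a k := by
    rw [← nsmul_eq_mul, ← Ring.descPochhammer_eq_factorial_smul_choose,
      ← descPochhammer_map (Int.castRingHom ℚ), Polynomial.eval_map,
      Polynomial.smeval_def, Polynomial.eval₂_eq_sum]
    simp [Polynomial.sum_def, Polynomial.smul_pow]
  have hk : (k ! : ℚ) ≠ 0 := by positivity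
  rw [Polynomial.eval_mul, h, Polynomial.eval_C]
  field_simp

theorem derivation_prod {R A ι : Type*} [CommSemiring R] [CommSemiring A] [Algebra R A]
    [DecidableEq ι] (D : Derivation R A A) (s : Finset ι) (f : ι → A) :
    D (∏ i ∈ s, f i) = ∑ i ∈ s, (∏ j ∈ s.erase i, f j) * D (f i) := by
  induction s using Finset.induction_on with
  | empty => simp
  | insert i s hi ih =>
    rw [Finset.prod_insert hi, D.leibniz, ih, Finset.sum_insert hi, Finset.erase_insert hi,
      smul_eq_mul, smul_eq_mul, Finset.mul_sum, add_comm]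
    congr 1
    refine Finset.sum_congr rfl fun j hj => ?_
    rw [Finset.erase_insert_of_ne (by rintro rfl; exact hi hj), Finset.prod_insert, mul_assoc]
    exact fun h => hi (Finset.mem_of_mem_erase h)

/-- Product formula: sums over all maps of products of weights that depend only on the sizes of the
fibres (of their composition with `p`) are coefficients of products of exponential series. -/
theorem sum_prod_weight_fiber {K L : Type*} [Fintype K] [DecidableEq K] [Fintype L]
    (p : L → K) (N : ℕ) (a : K → ℕ → ℚ) :
    ∑ χ : Fin N → L, ∏ k, a k (Finset.univ.filter fun v => p (χ v) = k).card =
      (N ! : ℚ) * coeff N (∏ k, PowerSeries.mk fun n =>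
        a k n * ((Finset.univ.filter fun l => p l = k).card : ℚ) ^ n / (n ! : ℚ)) := by
  induction N generalizing a with
  | zero => simp [map_prod]
  | succ N ih =>
    set c : K → ℚ := fun k => ((Finset.univ.filter fun l => p l = k).card : ℚ) with hc
    set F : (ℕ → ℚ) → ℚ → ℚ⟦X⟧ := fun b c => PowerSeries.mk fun n => b n * c ^ n / (n ! : ℚ)
      with hF
    -- Differentiating an exponential series shifts its weights and brings out the fibre size `c`.
    have hder : ∀ b c, derivative ℚ (F b c) = c • F (fun n => b (n + 1)) c := by
      intro b c
      ext n
      rw [coeff_derivative, hF, coeff_smul, coeff_mk, coeff_mk, Nat.factorial_succ]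
      push_cast
      have : (n ! : ℚ) ≠ 0 := by positivity
      rw [smul_eq_mul]
      field_simp
      ring
    -- Fix the image `l` of the first point: the weight at `p l` is shifted by one. Summing over `l`
    -- matches the Leibniz rule, the factor `c k` counting the `l` over `k`.
    have hstep : ∑ χ : Fin (N + 1) → L, ∏ k, a k (Finset.univ.filter fun v => p (χ v) = k).card =
        ∑ l : L, ∑ χ : Fin N → L, ∏ k,
          Function.update a (p l) (fun n => a (p l) (n + 1)) k
            (Finset.univ.filter fun v => p (χ v) = k).card := by
      rw [← Fintype.sum_prod_type', ← (Fin.consEquiv fun _ => L).sum_comp]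
      refine Finset.sum_congr rfl fun x _ => Finset.prod_congr rfl fun k _ => ?_
      have hcard : (Finset.univ.filter fun v => p ((Fin.consEquiv fun _ => L) x v) = k).card =
          (if p x.1 = k then 1 else 0) + (Finset.univ.filter fun v => p (x.2 v) = k).card := by
        rw [Fin.card_filter_univ_succ]
        simp only [Fin.consEquiv_apply, Fin.cons_zero, Fin.cons_succ]
        split_ifs <;> simp [add_comm]
      rw [hcard]
      by_cases h : p x.1 = k
      · subst h
        simp [add_comm]
      · rw [Function.update_of_ne (Ne.symm h), if_neg h, zero_add]
    rw [hstep]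
    simp_rw [ih]
    change ∑ l : L, (N ! : ℚ) * coeff N (∏ k, F (Function.update a (p l)
      (fun n => a (p l) (n + 1)) k) (c k)) = ((N + 1)! : ℚ) * coeff (N + 1) (∏ k, F (a k) (c k))
    have hprod : derivative ℚ (∏ k, F (a k) (c k)) =
        ∑ l : L, ∏ k, F (Function.update a (p l) (fun n => a (p l) (n + 1)) k) (c k) := by
      rw [derivation_prod, ← Finset.sum_fiberwise Finset.univ p]
      refine Finset.sum_congr rfl fun k _ => ?_
      rw [hder, mul_smul_comm, Finset.sum_congr rfl (g := fun _ =>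
        (∏ j ∈ Finset.univ.erase k, F (a j) (c j)) * F (fun n => a k (n + 1)) (c k))]
      · rw [Finset.sum_const, ← Nat.cast_smul_eq_nsmul ℚ]
      · intro l hl
        obtain rfl := (Finset.mem_filter.1 hl).2
        rw [← Finset.prod_erase_mul _ _ (Finset.mem_univ (p l)), Function.update_self]
        congr 1
        refine Finset.prod_congr rfl fun j hj => ?_
        rw [Function.update_of_ne (Finset.ne_of_mem_erase hj)]
    rw [Nat.factorial_succ, ← Finset.mul_sum, ← map_sum, ← hprod, coeff_derivative]
    push_cast
    ring

end Series

/-! ### Counting evenly coloured maps -/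

section Counting

open PowerSeries

variable {d r : ℕ}

/-- The colour modulo `d` of an element of the cyclic group. -/
def colour (d m : ℕ) [NeZero d] (g : CyclicGroup m) : Fin d :=
  ⟨g.toAdd.val % d, Nat.mod_lt _ (NeZero.pos d)⟩

/-- The residues of colour $j$ are exactly $j+dt$ with $0\le t<r$. -/
theorem card_colour_fiber (d r : ℕ) [NeZero d] [NeZero r] (j : Fin d) :
    (Finset.univ.filter fun g : CyclicGroup (d * r) => colour d (d * r) g = j).card = r := by
  have hlt : ∀ t : Fin r, j.1 + d * t.1 < d * r := fun t => by
    have h1 : d * (t.1 + 1) ≤ d * r := Nat.mul_le_mul_left d t.2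
    have := j.2
    rw [mul_add] at h1
    omega
  have hval : ∀ t : Fin r, ((j.1 + d * t.1 : ℕ) : ZMod (d * r)).val = j.1 + d * t.1 := fun t =>
    ZMod.val_cast_of_lt (hlt t)
  have h : (Finset.univ : Finset (Fin r)).card =
      (Finset.univ.filter fun g : CyclicGroup (d * r) => colour d (d * r) g = j).card := by
    refine Finset.card_bij (fun t _ => Multiplicative.ofAdd ((j.1 + d * t.1 : ℕ) : ZMod (d * r)))
      ?_ ?_ ?_
    · intro t _
      rw [Finset.mem_filter]
      refine ⟨Finset.mem_univ _, Fin.ext ?_⟩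
      simp only [colour, toAdd_ofAdd, hval]
      rw [Nat.add_mul_mod_self_left, Nat.mod_eq_of_lt j.2]
    · intro s _ t _ hst
      have := congrArg ZMod.val (Multiplicative.ofAdd.injective hst)
      rw [hval, hval] at this
      exact Fin.ext (Nat.eq_of_mul_eq_mul_left (NeZero.pos d) (Nat.add_left_cancel this))
    · intro g hg
      have hg' : g.toAdd.val % d = j.1 := congrArg Fin.val (Finset.mem_filter.1 hg).2
      refine ⟨⟨g.toAdd.val / d, Nat.div_lt_of_lt_mul (ZMod.val_lt _)⟩, Finset.mem_univ _, ?_⟩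
      rw [← hg', Nat.mod_add_div, ZMod.natCast_zmod_val, ofAdd_toAdd]
  rw [← h, Finset.card_fin]

open Classical in
/-- A map is evenly coloured if and only if there is a function counting, for every block, the
elements of any given colour. -/
theorem evenMap_iff_exists {n q m : ℕ} [NeZero d] {χ : Fin n → Option (Fin q × CyclicGroup m)} :
    EvenMap d χ ↔ ∃ b ∈ Fintype.piFinset fun _ : Fin q => Finset.range (n + 1),
      ∀ i j, (Finset.univ.filter fun v =>
        (χ v).map (Prod.map id (colour d m)) = some (i, j)).card = b i := by
  have key : ∀ (i : Fin q) (j : ℕ) (hj : j < d), (Finset.univ.filter fun v =>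
        (χ v).map (Prod.map id (colour d m)) = some (i, ⟨j, hj⟩)) =
      Finset.univ.filter fun a => ∃ g, χ a = some (i, g) ∧ g.toAdd.val ≡ j [MOD d] := by
    intro i j hj
    ext v
    rcases hv : χ v with _ | ⟨i', g⟩
    · simp [hv]
    · simp [hv, colour, Nat.ModEq, Nat.mod_eq_of_lt hj]
  constructor
  · intro h
    refine ⟨fun i => (Finset.univ.filter fun v =>
        (χ v).map (Prod.map id (colour d m)) = some (i, 0)).card, ?_, fun i j => ?_⟩
    · rw [Fintype.mem_piFinset]
      intro i
      rw [Finset.mem_range, Nat.lt_succ_iff]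
      exact (Finset.card_le_univ _).trans_eq (Fintype.card_fin n)
    · have h1 := key i j.1 j.2
      have h2 := key i 0 (NeZero.pos d)
      beta_reduce
      rw [show (0 : Fin d) = ⟨0, NeZero.pos d⟩ from rfl, h1, h2]
      convert h i j.1 0
  · rintro ⟨b, -, hb⟩ i
    have h : ∀ j : ℕ, (Finset.univ.filter fun a =>
        ∃ g, χ a = some (i, g) ∧ g.toAdd.val ≡ j [MOD d]).card = b i := by
      intro j
      rw [← hb i ⟨j % d, Nat.mod_lt _ (NeZero.pos d)⟩, key]
      simp only [Nat.ModEq, Nat.mod_mod]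
      congr!
    intro j k
    convert (h j).trans (h k).symm

/-- The number of maps with a prescribed number of elements for every block and colour. -/
theorem card_map_of_colour_count {q : ℕ} [NeZero d] [NeZero r] (n e : ℕ) (he : e < d)
    (b : Fin q → ℕ) :
    ((Finset.univ.filter fun χ : Fin (d * n + e) → Option (Fin q × CyclicGroup (d * r)) =>
      ∀ i j, (Finset.univ.filter fun v =>
        (χ v).map (Prod.map id (colour d (d * r))) = some (i, j)).card = b i).card : ℚ) =
      ((d * n + e)! : ℚ) * coeff n ((PowerSeries.mk fun m => (1 : ℚ) / ((d * m + e)! : ℚ)) *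
        ∏ i, monomial (b i) ((r : ℚ) ^ (d * b i) / ((b i)! : ℚ) ^ d)) := by
  set N := d * n + e with hN
  -- The zero block is unrestricted; each colour class of block `i` must have size exactly `b i`.
  let a : Option (Fin q × Fin d) → ℕ → ℚ := fun k m =>
    k.elim 1 fun x => if m = b x.1 then 1 else 0
  have h := sum_prod_weight_fiber
    (Option.map (Prod.map id (colour d (d * r))) :
      Option (Fin q × CyclicGroup (d * r)) → Option (Fin q × Fin d)) N a
  have hfib : ∀ x : Fin q × Fin d, (Finset.univ.filter
      fun l : Option (Fin q × CyclicGroup (d * r)) =>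
        l.map (Prod.map id (colour d (d * r))) = some x).card = r := by
    rintro ⟨i, j⟩
    refine Eq.trans (Eq.symm ?_) (card_colour_fiber d r j)
    refine Finset.card_bij (fun g _ => some (i, g)) ?_ ?_ ?_
    · intro g hg
      refine Finset.mem_filter.2 ⟨Finset.mem_univ _, ?_⟩
      rw [Option.map_some, Prod.map_apply, (Finset.mem_filter.1 hg).2, id_eq]
    · intro g _ g' _ hgg
      simpa using hgg
    · rintro (_ | ⟨i', g⟩) hl
      · simp at hl
      · simp only [Finset.mem_filter, Finset.mem_univ, true_and, Option.map_some, Prod.map_apply,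
          id_eq, Option.some.injEq, Prod.mk.injEq] at hl
        exact ⟨g, by simpa using hl.2, by rw [hl.1]⟩
  have hnone : (Finset.univ.filter fun l : Option (Fin q × CyclicGroup (d * r)) =>
        l.map (Prod.map id (colour d (d * r))) = none).card = 1 := by
    rw [Finset.card_eq_one]
    exact ⟨none, by ext l; simp⟩
  have hL : ∀ χ : Fin N → Option (Fin q × CyclicGroup (d * r)),
      ∏ k, a k (Finset.univ.filter fun v =>
        (χ v).map (Prod.map id (colour d (d * r))) = k).card =
      if ∀ i j, (Finset.univ.filter fun v =>
        (χ v).map (Prod.map id (colour d (d * r))) = some (i, j)).card = b i then 1 else 0 := by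
    intro χ
    rw [Fintype.prod_option]
    simp only [a, Option.elim, one_mul]
    rw [Finset.prod_ite_zero]
    simp [Prod.forall]
  rw [Finset.sum_congr rfl fun χ _ => hL χ, Finset.sum_boole, Fintype.prod_option] at h
  rw [h, hnone]
  simp only [hfib]
  have hmono : ∀ x : Fin q × Fin d, (PowerSeries.mk fun m =>
      a (some x) m * ((r : ℕ) : ℚ) ^ m / (m ! : ℚ)) =
      C ((r : ℚ) ^ b x.1 / ((b x.1)! : ℚ)) * X ^ b x.1 := by
    intro x
    ext m
    rw [coeff_mk, coeff_C_mul_X_pow]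
    simp only [a, Option.elim]
    split_ifs with hm
    · rw [hm, one_mul]
    · simp
  congr 1
  simp only [hmono, monomial_eq_C_mul_X_pow]
  rw [Fintype.prod_prod_type]
  simp only [Finset.prod_const, Finset.card_fin, mul_pow, Finset.prod_mul_distrib,
    ← pow_mul, ← map_pow, ← map_prod, Finset.prod_pow_eq_pow_sum]
  rw [mul_left_comm, mul_left_comm _ (C _), coeff_C_mul, coeff_C_mul, coeff_mul_X_pow',
    coeff_mul_X_pow']
  congr 1
  · refine Finset.prod_congr rfl fun i _ => ?_
    rw [div_pow, ← pow_mul, mul_comm d]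
  · rw [← Finset.sum_mul]
    set M := ∑ i, b i
    -- The nonzero blocks use $dM$ points, leaving $d(n-M)+e$ for the zero block. Since $e<d$, this
    -- is possible exactly when $M\le n$, so $x$ may mark $d$ points at a time.
    have hiff : M * d ≤ N ↔ M ≤ n := by
      constructor
      · intro h1
        by_contra h2
        have h3 : d * (n + 1) ≤ d * M := Nat.mul_le_mul_left d (by omega)
        rw [mul_comm] at h1
        rw [mul_add] at h3
        omega
      · intro h1
        have := Nat.mul_le_mul_left d h1
        rw [mul_comm]
        omega
    by_cases hM : M ≤ n
    · rw [if_pos (hiff.2 hM), if_pos hM, coeff_mk, coeff_mk]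
      have : N - M * d = d * (n - M) + e := by
        obtain ⟨t, rfl⟩ := Nat.exists_eq_add_of_le hM
        rw [hN, Nat.add_sub_cancel_left, mul_add, mul_comm M d]
        omega
      rw [this]
      simp [a]
    · rw [if_neg (fun h => hM (hiff.1 h)), if_neg hM]

/-- The number of evenly coloured maps to `q` labelled blocks, as a coefficient of a series. -/
theorem card_evenMap (d r n e q : ℕ) [NeZero d] [NeZero r] (he : e < d) :
    (Nat.card {χ : Fin (d * n + e) → Option (Fin q × CyclicGroup (d * r)) // EvenMap d χ} : ℚ) =
      ((d * n + e)! : ℚ) * coeff n ((PowerSeries.mk fun m => (1 : ℚ) / ((d * m + e)! : ℚ)) *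
        (PowerSeries.mk fun m => (r : ℚ) ^ (d * m) / (m ! : ℚ) ^ d) ^ q) := by
  classical
  set N := d * n + e with hN
  set A : ℚ⟦X⟧ := PowerSeries.mk fun m => (1 : ℚ) / ((d * m + e)! : ℚ)
  set w : ℕ → ℚ := fun m => (r : ℚ) ^ (d * m) / (m ! : ℚ) ^ d
  have h1 : (Finset.univ.filter fun χ : Fin N → Option (Fin q × CyclicGroup (d * r)) =>
      EvenMap d χ) = (Fintype.piFinset fun _ : Fin q => Finset.range (N + 1)).biUnion fun b =>
        Finset.univ.filter fun χ : Fin N → Option (Fin q × CyclicGroup (d * r)) =>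
          ∀ i j, (Finset.univ.filter fun v =>
            (χ v).map (Prod.map id (colour d (d * r))) = some (i, j)).card = b i := by
    ext χ
    rw [Finset.mem_filter, evenMap_iff_exists, Finset.mem_biUnion]
    simp only [Finset.mem_univ, true_and, Finset.mem_filter]
  have h2 : (∑ m ∈ Finset.range (N + 1), monomial m (w m)) ^ q =
      ∑ b ∈ Fintype.piFinset fun _ : Fin q => Finset.range (N + 1),
        ∏ i, monomial (b i) (w (b i)) := by
    rw [← Finset.prod_univ_sum (fun _ : Fin q => Finset.range (N + 1))
      (fun _ m => monomial m (w m))]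
    simp
  -- Truncation makes the $q$-th power a finite sum over `b`; degrees above $N\ge n$ do not affect
  -- coefficient `n`.
  have h3 : coeff n (A * PowerSeries.mk w ^ q) =
      coeff n (A * (∑ m ∈ Finset.range (N + 1), monomial m (w m)) ^ q) := by
    rw [← sub_eq_zero, ← map_sub, ← mul_sub]
    have hdvd : X ^ (N + 1) ∣ PowerSeries.mk w - ∑ m ∈ Finset.range (N + 1), monomial m (w m) := by
      rw [X_pow_dvd_iff]
      intro m hm
      simp [coeff_monomial, Finset.sum_ite_eq, hm]
    have hn : n < N + 1 := by
      have : 1 * n ≤ d * n := Nat.mul_le_mul_right n (NeZero.pos d)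
      omega
    exact X_pow_dvd_iff.1 ((hdvd.trans (sub_dvd_pow_sub_pow _ _ q)).mul_left A) n hn
  rw [Nat.card_eq_fintype_card, Fintype.card_subtype, h1, Finset.card_biUnion, h3, h2,
    Finset.mul_sum, map_sum, Finset.mul_sum, Nat.cast_sum]
  · exact Finset.sum_congr rfl fun b _ => card_map_of_colour_count n e he b
  · intro b _ b' _ hne
    rw [Function.onFun, Finset.disjoint_left]
    intro χ hχ hχ'
    refine hne (funext fun i => ?_)
    rw [← (Finset.mem_filter.1 hχ).2 i 0, ← (Finset.mem_filter.1 hχ').2 i 0]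

end Counting

/-! ### Rescaling and the final evaluation -/

theorem mainTheorem9 (d r e : ℕ) [NeZero d] [NeZero r] (hd : 2 ≤ d) (he : e < d) :
    (PowerSeries.mk fun n : ℕ =>
      (if d * n + e = 0 then (-1 : ℚ)
        else (mobiusNumber (DivisibleDowling (d * n + e) (d * r) d d) : ℚ)) *
        (((e ! : ℚ) * (d : ℚ) ^ n) / (((d * n + e)! : ℚ) * (r : ℚ) ^ ((d - 1) * n)))) =
    -(PowerSeries.mk fun n : ℕ =>
        ((e ! : ℚ) * (d : ℚ) ^ n) / (((d * n + e)! : ℚ) * (r : ℚ) ^ ((d - 1) * n))) *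
      seriesPow (PowerSeries.mk fun n : ℕ => ((d : ℚ) ^ n * (r : ℚ) ^ n) / (n ! : ℚ) ^ d)
        (-1 / ((d : ℚ) * (r : ℚ))) := by
  set A : PowerSeries ℚ := PowerSeries.mk fun n : ℕ =>
    ((e ! : ℚ) * (d : ℚ) ^ n) / (((d * n + e)! : ℚ) * (r : ℚ) ^ ((d - 1) * n)) with hA
  set E : PowerSeries ℚ :=
    PowerSeries.mk fun n : ℕ => ((d : ℚ) ^ n * (r : ℚ) ^ n) / (n ! : ℚ) ^ d with hE
  have hr : (r : ℚ) ≠ 0 := Nat.cast_ne_zero.2 (NeZero.ne r)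
  have hd' : (d : ℚ) ≠ 0 := Nat.cast_ne_zero.2 (NeZero.ne d)
  have hE1 : PowerSeries.constantCoeff E = 1 := by
    rw [← PowerSeries.coeff_zero_eq_constantCoeff_apply, hE, PowerSeries.coeff_mk]
    simp
  -- Replacing $x$ by $sx$ turns the block weight $r^{dm}$ into $d^m r^m$ and, up to $e!$, the
  -- zero-block series into `A`.
  set s : ℚ := (d : ℚ) / (r : ℚ) ^ (d - 1) with hs
  have hs0 : s ≠ 0 := div_ne_zero hd' (pow_ne_zero _ hr)
  have hAs : A = PowerSeries.C (e ! : ℚ) *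
      PowerSeries.rescale s (PowerSeries.mk fun m => (1 : ℚ) / ((d * m + e)! : ℚ)) := by
    ext m
    rw [hA, PowerSeries.coeff_mk, PowerSeries.coeff_C_mul, PowerSeries.coeff_rescale,
      PowerSeries.coeff_mk, hs, div_pow, ← pow_mul]
    field_simp
  have hEs : E =
      PowerSeries.rescale s (PowerSeries.mk fun m => (r : ℚ) ^ (d * m) / (m ! : ℚ) ^ d) := by
    ext m
    rw [hE, PowerSeries.coeff_mk, PowerSeries.coeff_rescale, PowerSeries.coeff_mk, hs, div_pow,
      ← pow_mul]
    have : (r : ℚ) ^ (d * m) = (r : ℚ) ^ ((d - 1) * m) * (r : ℚ) ^ m := by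
      rw [← pow_add]
      congr 1
      obtain ⟨c, rfl⟩ : ∃ c, d = c + 1 := ⟨d - 1, by omega⟩
      rw [Nat.add_sub_cancel]
      ring
    rw [this]
    field_simp
  ext n
  rw [PowerSeries.coeff_mk, neg_mul, map_neg]
  by_cases hn : d * n + e = 0
  -- The inversion needs a nonempty ground set; in this case the convention $-1$ agrees with the
  -- constant term of the right side.
  · obtain ⟨h1, rfl⟩ : d * n = 0 ∧ e = 0 := by omega
    obtain rfl : n = 0 := (Nat.mul_eq_zero.1 h1).resolve_left (by omega)
    rw [if_pos hn, coeff_mul_seriesPow hE1]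
    simp [hA]
  · rw [if_neg hn]
    obtain ⟨p, hp⟩ := exists_polynomial_coeff_mul_seriesPow hE1 A n
    -- The factor undoing $e!$ and the rescaling, so that `C c * p` counts even maps at every
    -- natural `q`.
    set c : ℚ := ((d * n + e)! : ℚ) / ((e ! : ℚ) * s ^ n) with hc
    have hcount : ∀ q : ℕ, (Nat.card {χ : Fin (d * n + e) → Option (Fin q × CyclicGroup (d * r)) //
        EvenMap d χ} : ℚ) = (Polynomial.C c * p).eval (q : ℚ) := by
      intro q
      rw [card_evenMap d r n e q he, Polynomial.eval_mul, Polynomial.eval_C, hp,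
        seriesPow_natCast hE1, hAs, hEs, ← map_pow, mul_assoc, ← map_mul,
        PowerSeries.coeff_C_mul, PowerSeries.coeff_rescale, hc]
      have : (e ! : ℚ) ≠ 0 := by positivity
      field_simp
    rw [DivisibleDowling.mobiusNumber_eq_neg_eval hd (dvd_mul_right d r) hn _ hcount,
      Polynomial.eval_mul, Polynomial.eval_C, hp, hc, hs, div_pow, ← pow_mul]
    have h1 : (e ! : ℚ) ≠ 0 := by positivity
    have h2 : ((d * n + e)! : ℚ) ≠ 0 := by positivity
    push_cast
    field_simp
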